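/- Throughout, a compactum is a compact Hausdorff space. Let $G$ be a locally compact Hausdorff topological group that is compactly generated, i.e. generated by some compact subset. For a continuous action of $G$ on a compactum $T$, a net $(g_n)_n$ on $G$ \emph{collapses} to $a\in T$ except at $b\in T$ if for every compact $K\subseteq T\setminus\{b\}$ and every neighbourhood $U$ of $a$ one has $g_n\cdot K\subseteq U$ for $n$ large enough. The action is a \emph{convergence action} if every net on $G$ without cluster point in $G$ has a collapsing subnet, i.e. a subnet that collapses to some $a\in T$ except at some $b\in T$ (possibly $a=b$). A convergence action is \emph{minimal} if its limit set, the set of all $a\in T$ such that some net on $G$ collapses to $a$ except at some $b\in T$, is the whole of $T$. Given minimal convergence actions of $G$ on compacta $M$ and $N$, a \emph{pullback} of these actions is a triple $(P,\pi_M,\pi_N)$ where $P$ is a compactum with a minimal convergence action of $G$ and $\pi_M:P\to M$, $\pi_N:P\to N$ are surjective $G$-equivariant continuous maps. It is a \emph{minimal pullback} if for every pullback $(T,p_M,p_N)$ of the same actions there is a $G$-equivariant continuous map $\phi:T\to P$ with $\pi_M\circ\phi=p_M$ and $\pi_N\circ\phi=p_N$. \textbf{Corollary E.} Any two minimal convergence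 actions of $G$ on totally disconnected compacta $M$ and $N$, each containing more than two points, admit a minimal pullback. -/

import Mathlib

open Set Filter Topology

universe u v w x y

namespace ConvergenceAction

/-- A topological group is compactly generated if some compact subset generates it as a group
(not to be confused with compactly generated *spaces*). -/
def CompactlyGeneratedGroup (G : Type u) [Group G] [TopologicalSpace G] : Prop :=
  ∃ K : Set G, IsCompact K ∧ Subgroup.closure K = ⊤

/-! Nets on `G` are represented by their filters of tails: a net on `G` is a proper filter on `G`,
its subnets correspond to the proper filters below it, and a property holds for `n` large enough
in the net if and only if it holds eventually along the filter. -/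

/-- A net on `G` is wandering if no point of `G` is a cluster point of it. -/
def IsWandering {G : Type u} [TopologicalSpace G] (F : Filter G) : Prop :=
  ∀ g : G, ¬ ClusterPt g F

/-- The net `F` of elements of `G` collapses to `a` except at `b`: for every compact subset `K` of
`T \ {b}` and every neighbourhood `U` of `a`, one has `g • K ⊆ U` for `g` far enough in the net. -/
def Collapses {G : Type u} {T : Type v} [SMul G T] [TopologicalSpace T]
    (F : Filter G) (b a : T) : Prop :=
  ∀ K : Set T, IsCompact K → b ∉ K → ∀ U ∈ 𝓝 a, ∀ᶠ g in F, ∀ t ∈ K, g • t ∈ U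

/-- The action of `G` on `T` has the convergence property: every wandering net on `G` has a
collapsing subnet. -/
def HasConvergenceProperty (G : Type u) (T : Type v) [TopologicalSpace G] [TopologicalSpace T]
    [SMul G T] : Prop :=
  ∀ F : Filter G, F.NeBot → IsWandering F →
    ∃ F' : Filter G, F' ≤ F ∧ F'.NeBot ∧ ∃ b a : T, Collapses F' b a

/-- The limit set: the set of all points to which some net on `G` collapses. -/
def limitSet (G : Type u) (T : Type v) [TopologicalSpace T] [SMul G T] : Set T :=
  {a | ∃ b : T, ∃ F : Filter G, F.NeBot ∧ Collapses F b a}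

/-- `G` acts continuously on the compactum (compact Hausdorff space) `T`, with the convergence
property, and minimally: the limit set is the whole of `T`. -/
structure IsMinimalConvergenceAction (G : Type u) (T : Type v) [Group G] [TopologicalSpace G]
    [TopologicalSpace T] [MulAction G T] : Prop where
  compactSpace : CompactSpace T
  t2Space : T2Space T
  continuousSMul : ContinuousSMul G T
  convergence : HasConvergenceProperty G T
  limitSet_eq : limitSet G T = univ

/-- `G`-morphisms: equivariant continuous maps. -/
structure IsGMorphism (G : Type u) {S : Type v} {T : Type w} [TopologicalSpace S]
    [TopologicalSpace T] [SMul G S] [SMul G T] (f : S → T) : Prop where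
  continuous : Continuous f
  map_smul : ∀ (g : G) (s : S), f (g • s) = g • f s

/-- `(P, πM, πN)` is a pullback of the actions of `G` on `M` and `N`: the action of `G` on the
compactum `P` is a minimal convergence action, and `πM`, `πN` are surjective `G`-morphisms. -/
structure IsPullback (G : Type u) {P : Type x} {M : Type v} {N : Type w} [Group G]
    [TopologicalSpace G] [TopologicalSpace P] [MulAction G P] [TopologicalSpace M] [MulAction G M]
    [TopologicalSpace N] [MulAction G N] (πM : P → M) (πN : P → N) : Prop where
  action : IsMinimalConvergenceAction G P
  left_morphism : IsGMorphism G πM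
  left_surjective : Function.Surjective πM
  right_morphism : IsGMorphism G πN
  right_surjective : Function.Surjective πN

/-- The pullback `(P, πM, πN)` is minimal: every pullback `(T, pM, pN)` maps to it by a
`G`-morphism over `M` and `N`. Here `T` ranges over an arbitrary universe `y'`. -/
structure IsMinimalPullback.{y', u', x', v', w'} (G : Type u') {P : Type x'} {M : Type v'}
    {N : Type w'} [Group G] [TopologicalSpace G] [TopologicalSpace P] [MulAction G P]
    [TopologicalSpace M] [MulAction G M] [TopologicalSpace N] [MulAction G N]
    (πM : P → M) (πN : P → N) : Prop where
  isPullback : IsPullback G πM πN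
  factors : ∀ (T : Type y') [TopologicalSpace T] [MulAction G T] (pM : T → M) (pN : T → N),
    IsPullback G pM pN →
      ∃ φ : T → P, IsGMorphism G φ ∧ πM ∘ φ = pM ∧ πN ∘ φ = pN

end ConvergenceAction

/-! The pullback is the set P ⊆ M × N of pairs attracted simultaneously by one net on G. Every
pullback maps into P, because a net collapsing on it also collapses on both quotients. The
difficulty is the convergence property of P: an ultrafilter on G collapsing on M (to a except at b)
and on N (to a' except at b') must collapse on P to (a, a') except at (b, b').

The delicate case, `tendsto_smul_of_mem_jointLimitSet`, is an ends argument. A clopen set A leaves a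
trace on G, its `majority` set, whose coboundary is relatively compact. If the claim fails for
clopen A ⊆ M and B ⊆ N, the set of h with g * h on the A side and h on the B side is eventually
nonempty and misses 1, so compact generation yields an edge leaving it. At this edge g * h or h
stays bounded; the dynamics of g⁻¹ on N or of g on M then put h outside the set. -/

namespace ConvergenceAction

/-! ### Collapsing and wandering nets -/

section Collapses

variable {G : Type u} [Group G] {T : Type v} [TopologicalSpace T] [MulAction G T]

theorem Collapses.mono {F F' : Filter G} {b a : T} (h : Collapses F b a) (hF : F' ≤ F) :
    Collapses F' b a :=
  fun K hK hb U hU => hF (h K hK hb U hU)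

/-- Points converging to a point other than the repelling one are moved to the attracting point. -/
theorem Collapses.tendsto_smul [CompactSpace T] [T2Space T] {F : Filter G} {b a : T}
    (h : Collapses F b a) {ι : Type*} {l : Filter ι} {f : ι → G} (hf : Tendsto f l F)
    {x : ι → T} {x₀ : T} (hx : Tendsto x l (𝓝 x₀)) (hb : x₀ ≠ b) :
    Tendsto (fun i => f i • x i) l (𝓝 a) := by
  refine tendsto_def.2 fun U hU => ?_
  obtain ⟨K, hK, hKb, hKc⟩ := local_compact_nhds (isOpen_ne.mem_nhds hb)
  filter_upwards [hf.eventually (h K hKc (fun hbK => hKb hbK rfl) U hU),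
    hx.eventually_mem hK] with i hi hxi
  exact hi _ hxi

theorem Collapses.tendsto_smul_const {F : Filter G} {b a : T}
    (h : Collapses F b a) {t : T} (ht : t ≠ b) : Tendsto (fun g : G => g • t) F (𝓝 a) := by
  refine tendsto_def.2 fun U hU => ?_
  filter_upwards [h {t} isCompact_singleton (fun hb => ht hb.symm) U hU] with g hg
  exact hg t rfl

/-- By complements: g sends Vᶜ into Kᶜ exactly when g⁻¹ sends K into V. -/
theorem Collapses.inv [CompactSpace T] [T2Space T] {F : Filter G} {b a : T}
    (h : Collapses F b a) : Collapses (F.map (fun g => g⁻¹)) a b := by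
  intro K hK haK U hU
  obtain ⟨V, hVU, hV, hbV⟩ := mem_nhds_iff.1 hU
  have := h Vᶜ hV.isClosed_compl.isCompact (fun hb => hb hbV) Kᶜ
    (hK.isClosed.isOpen_compl.mem_nhds haK)
  refine eventually_map.2 ?_
  filter_upwards [this] with g hg t ht
  by_contra htU
  have := hg (g⁻¹ • t) (fun hV => htU (hVU hV))
  rw [smul_inv_smul] at this
  exact this ht

theorem Collapses.mul_left [TopologicalSpace G] [ContinuousSMul G T] {F : Filter G} {b a : T}
    (h : Collapses F b a) (g : G) : Collapses (F.map (fun k => g * k)) b (g • a) := by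
  intro K hK hb U hU
  refine eventually_map.2 ?_
  filter_upwards [h K hK hb _ ((continuous_const_smul g).continuousAt hU)] with k hk t ht
  rw [mul_smul]
  exact hk t ht

theorem Collapses.map [CompactSpace T] {S : Type w} [TopologicalSpace S] [T2Space S]
    [MulAction G S] {f : T → S} (hf : IsGMorphism G f) (hs : Function.Surjective f)
    {F : Filter G} {b a : T} (h : Collapses F b a) : Collapses F (f b) (f a) := by
  intro K hK hb U hU
  filter_upwards [h (f ⁻¹' K) (hK.isClosed.preimage hf.continuous).isCompact hb _
    (hf.continuous.continuousAt hU)] with g hg s hsK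
  obtain ⟨t, rfl⟩ := hs s
  rw [← hf.map_smul]
  exact hg t hsK

/-- The filter `F` collapses to `a` except at some point. -/
def Attracts (F : Filter G) (a : T) : Prop := ∃ b : T, Collapses F b a

theorem exists_injective_fin_three {T : Type*} (h : 2 < ENat.card T) :
    ∃ t : Fin 3 → T, Function.Injective t := by
  have h3 : (3 : ℕ∞) ≤ (univ : Set T).encard := by
    rw [Set.encard_univ]
    exact Order.add_one_le_of_lt h
  obtain ⟨s, -, hs⟩ := Set.exists_subset_encard_eq h3
  obtain ⟨x, y, z, hxy, hxz, hyz, -⟩ := Set.encard_eq_three.1 hs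
  refine ⟨![x, y, z], fun i j hij => ?_⟩
  fin_cases i <;> fin_cases j <;> simp_all

/-- Three points are taken so that two of them always avoid the repelling point. -/
theorem exists_two_ne {T : Type*} {t : Fin 3 → T} (ht : Function.Injective t) (b : T) :
    ∃ i j, i ≠ j ∧ t i ≠ b ∧ t j ≠ b := by
  by_cases h0 : t 0 = b
  · exact ⟨1, 2, by decide, h0 ▸ ht.ne (by decide), h0 ▸ ht.ne (by decide)⟩
  by_cases h1 : t 1 = b
  · exact ⟨0, 2, by decide, h0, h1 ▸ ht.ne (by decide)⟩
  · exact ⟨0, 1, by decide, h0, h1⟩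

theorem Attracts.mono {F F' : Filter G} {a : T} (h : Attracts F a) (hF : F' ≤ F) :
    Attracts F' a :=
  h.imp fun _ hb => hb.mono hF

/-- A collapsing net is wandering. -/
theorem Attracts.isWandering [TopologicalSpace G] [ContinuousSMul G T] [T2Space T]
    {t : Fin 3 → T} (ht : Function.Injective t) {F : Filter G} {a : T} (h : Attracts F a) :
    IsWandering F := by
  intro g hg
  obtain ⟨b, h⟩ := h
  have : (𝓝 g ⊓ F).NeBot := hg
  -- Near a cluster point g, k • s tends both to g • s and to a, so g would identify two of the
  -- three points.
  have key : ∀ s, s ≠ b → g • s = a := fun s hs =>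
    tendsto_nhds_unique (f := fun k : G => k • s) (l := 𝓝 g ⊓ F)
      (((continuous_id.smul continuous_const).tendsto g).mono_left inf_le_left)
      ((h.tendsto_smul_const hs).mono_left inf_le_right)
  obtain ⟨i, j, hij, hi, hj⟩ := exists_two_ne ht b
  exact hij (ht (MulAction.injective g ((key _ hi).trans (key _ hj).symm)))

/-- An ultrafilter has no proper subnet, so it collapses itself. -/
theorem exists_collapses_of_isWandering [TopologicalSpace G] (hc : HasConvergenceProperty G T)
    {F : Ultrafilter G} (hF : IsWandering (F : Filter G)) :
    ∃ b a : T, Collapses (F : Filter G) b a := by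
  obtain ⟨F', hle, hne, b, a, h⟩ := hc F F.neBot hF
  exact ⟨b, a, h.mono (F.le_of_inf_neBot' (by rwa [inf_eq_left.2 hle]))⟩

theorem IsWandering.mono {G : Type u} [TopologicalSpace G] {F F' : Filter G}
    (h : IsWandering F) (hF : F' ≤ F) : IsWandering F' :=
  fun g hg => h g (hg.mono hF)

theorem IsWandering.compl_mem {G : Type u} [TopologicalSpace G] {F : Filter G}
    (h : IsWandering F) {C : Set G} (hC : IsCompact C) : Cᶜ ∈ F := by
  by_contra hF
  have : (F ⊓ 𝓟 C).NeBot := by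
    rwa [neBot_iff, Ne, ← compl_compl C, ← mem_iff_inf_principal_compl]
  obtain ⟨x, -, hx⟩ := hC (f := F ⊓ 𝓟 C) inf_le_right
  exact h x (hx.mono inf_le_left)

end Collapses

/-! ### Traces on G of clopen sets -/

section Majority

variable {G : Type u} [Group G] {T : Type v} [MulAction G T]

/-- The elements of `G` sending at least two of the three points `t 0, t 1, t 2` into `A`. -/
def majority (G : Type u) [Group G] {T : Type v} [MulAction G T] (t : Fin 3 → T) (A : Set T) :
    Set G :=
  {g | ∃ i j, i ≠ j ∧ g • t i ∈ A ∧ g • t j ∈ A}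

/-- Three is odd: exactly one of A and Aᶜ receives at least two of the points. -/
theorem majority_compl (t : Fin 3 → T) (A : Set T) : majority G t Aᶜ = (majority G t A)ᶜ := by
  ext g
  simp only [majority, mem_ofPred_eq, mem_compl_iff]
  constructor
  · rintro ⟨i, j, hij, hi, hj⟩ ⟨i', j', hij', hi', hj'⟩
    have h1 : i ≠ i' := by rintro rfl; exact hi hi'
    have h2 : i ≠ j' := by rintro rfl; exact hi hj'
    have h3 : j ≠ i' := by rintro rfl; exact hj hi'
    have h4 : j ≠ j' := by rintro rfl; exact hj hj'
    omega
  · intro h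
    by_contra! h'
    by_cases h0 : g • t 0 ∈ A
    · by_cases h1 : g • t 1 ∈ A
      · exact h ⟨0, 1, by decide, h0, h1⟩
      · exact h ⟨0, 2, by decide, h0, h' 1 2 (by decide) h1⟩
    · exact h ⟨1, 2, by decide, h' 0 1 (by decide) h0, h' 0 2 (by decide) h0⟩

variable [TopologicalSpace T] [CompactSpace T] [T2Space T] [TopologicalSpace G]
  [ContinuousSMul G T] {t : Fin 3 → T}

/-- A bounded right factor is harmless: x i • t k tends to x₀ • t k, which differs from b for at
least two indices k. -/
theorem Collapses.eventually_mul_mem_majority (ht : Function.Injective t) {F : Filter G}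
    {b a : T} (h : Collapses F b a) {ι : Type*} {l : Filter ι} {f : ι → G} (hf : Tendsto f l F)
    {x : ι → G} {x₀ : G} (hx : Tendsto x l (𝓝 x₀)) {A : Set T} (hA : A ∈ 𝓝 a) :
    ∀ᶠ i in l, f i * x i ∈ majority G t A := by
  obtain ⟨i, j, hij, hi, hj⟩ := exists_two_ne ht (x₀⁻¹ • b)
  have key : ∀ k, t k ≠ x₀⁻¹ • b → ∀ᶠ i in l, f i • x i • t k ∈ A := fun k hk =>
    h.tendsto_smul hf (hx.smul_const (t k)) (fun hb => hk (by rw [← hb, inv_smul_smul])) hA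
  filter_upwards [key i hi, key j hj] with k hki hkj
  exact ⟨i, j, hij, by rwa [mul_smul], by rwa [mul_smul]⟩

theorem Collapses.majority_mem (ht : Function.Injective t) {F : Filter G}
    {b a : T} (h : Collapses F b a) {A : Set T} (hA : A ∈ 𝓝 a) : majority G t A ∈ F := by
  simpa using h.eventually_mul_mem_majority ht tendsto_id (tendsto_const_nhds (x := (1 : G))) hA

/-- The coboundary of `majority G t A` is relatively compact when `A` is clopen. -/
theorem exists_tendsto_of_majority_coboundary [ContinuousMul G]
    (hc : HasConvergenceProperty G T)
    (ht : Function.Injective t) {A : Set T} (hA : IsClopen A) {K : Set G} (hK : IsCompact K)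
    {ι : Type*} {l : Ultrafilter ι} {f s : ι → G} (hs : ∀ᶠ i in l, s i ∈ K)
    (hf : ∀ᶠ i in l, f i ∈ majority G t A) (hfs : ∀ᶠ i in l, f i * s i ∉ majority G t A) :
    ∃ x, Tendsto f l (𝓝 x) := by
  by_contra! hx
  have hw : IsWandering (l.map f : Filter G) := fun g hg => hx g (Ultrafilter.clusterPt_iff.1 hg)
  obtain ⟨b, a, h⟩ := exists_collapses_of_isWandering hc hw
  obtain ⟨s₀, -, hs₀⟩ := isCompact_iff_ultrafilter_le_nhds.1 hK (l.map s)
    (le_principal_iff.2 hs)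
  have hfl : Tendsto f l (l.map f : Filter G) := tendsto_map
  have hsl : Tendsto s l (𝓝 s₀) := hs₀
  -- If f wanders, f and f * s end up on the same side of A, the one containing a.
  by_cases haA : a ∈ A
  · have := h.eventually_mul_mem_majority ht hfl hsl (hA.isOpen.mem_nhds haA)
    obtain ⟨i, hi, hi'⟩ := (this.and hfs).exists
    exact hi' hi
  · have : ∀ᶠ i in (l : Filter ι), f i ∈ majority G t Aᶜ :=
      h.majority_mem ht (hA.compl.isOpen.mem_nhds haA)
    obtain ⟨i, hi, hi'⟩ := (this.and hf).exists
    rw [majority_compl] at hi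
    exact hi hi'

end Majority

/-- A nonempty subset of a group which misses `1` is not stable under right translations by a
symmetric generating set. -/
theorem exists_mul_notMem_of_closure_eq_top {G : Type*} [Group G] {S : Set G}
    (hS : Subgroup.closure S = ⊤) (hinv : ∀ s ∈ S, s⁻¹ ∈ S) {E : Set G} (h1 : (1 : G) ∉ E)
    (hE : E.Nonempty) : ∃ h ∈ E, ∃ s ∈ S, h * s ∉ E := by
  by_contra! H
  obtain ⟨g, hg⟩ := hE
  have key : ∀ x, g * x ∈ E := by
    intro x
    have hx : x ∈ Subgroup.closure S := hS ▸ Subgroup.mem_top x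
    induction hx using Subgroup.closure_induction_right with
    | one => simpa using hg
    | mul_right x hx y hy ih => rw [← mul_assoc]; exact H _ ih y hy
    | mul_inv_cancel x hx y hy ih => rw [← mul_assoc]; exact H _ ih _ (hinv y hy)
  exact h1 (by simpa using key g⁻¹)

/-! ### Joint limits and their dynamics -/

section Joint

variable {G : Type u} [Group G]
  {M : Type v} [TopologicalSpace M] [MulAction G M] {N : Type w} [TopologicalSpace N]
  [MulAction G N]

variable (G M N) in
/-- The pairs of points to which some net on `G` collapses simultaneously. -/
def jointLimitSet : Set (M × N) :=
  {p | ∃ F : Filter G, F.NeBot ∧ Attracts F p.1 ∧ Attracts F p.2}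

variable [TopologicalSpace G]
  [CompactSpace M] [T2Space M] [TotallyDisconnectedSpace M] [ContinuousSMul G M]
  [CompactSpace N] [T2Space N] [TotallyDisconnectedSpace N] [ContinuousSMul G N]
  {t : Fin 3 → M} {r : Fin 3 → N}

theorem tendsto_smul_of_mem_jointLimitSet [ContinuousMul G] [ContinuousInv G]
    (hG : CompactlyGeneratedGroup G)
    (hM : HasConvergenceProperty G M) (ht : Function.Injective t)
    (hN : HasConvergenceProperty G N) (hr : Function.Injective r)
    {F : Ultrafilter G} {b a : M} (hFM : Collapses (F : Filter G) b a)
    {b' a' : N} (hFN : Collapses (F : Filter G) b' a') {m : G → M} {n : G → N}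
    (hmn : ∀ g, ∃ F : Filter G, F.NeBot ∧ Attracts F (m g) ∧ Attracts F (n g))
    {n₀ : N} (hn : Tendsto n F (𝓝 n₀)) (hn₀ : n₀ ≠ b') :
    Tendsto (fun g => g • m g) F (𝓝 a) := by
  by_cases hca : (F.map (fun g => g • m g)).lim = a
  · exact hca ▸ Ultrafilter.le_nhds_lim (F.map (fun g => g • m g))
  exfalso
  have hlim : Tendsto (fun g => g • m g) F (𝓝 (F.map (fun g => g • m g)).lim) :=
    Ultrafilter.le_nhds_lim (F.map (fun g => g • m g))
  generalize (F.map (fun g => g • m g)).lim = c at hca hlim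
  obtain ⟨A, hA, hcA, haA⟩ := exists_isClopen_of_totally_separated hca
  obtain ⟨B, hB, hnB, hbB⟩ := exists_isClopen_of_totally_separated hn₀
  obtain ⟨K, hK, hKG⟩ := hG
  set S := K ∪ K⁻¹
  have hSc : IsCompact S := hK.union hK.inv
  have hSG : Subgroup.closure S = ⊤ :=
    top_unique (hKG ▸ Subgroup.closure_mono subset_union_left)
  have hSinv : ∀ s ∈ S, s⁻¹ ∈ S := by
    rintro s (hs | hs)
    · exact Or.inr (by simpa using hs)
    · exact Or.inl hs
  -- A net attracted by (m g, n g) meets E g once g • m g ∈ A and n g ∈ B; and 1 ∉ E g once g moves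
  -- a majority of the t k near a ∉ A.
  let E : G → Set G := fun g => {h | g * h ∈ majority G t A ∧ h ∈ majority G r B}
  have hEne : ∀ᶠ g in (F : Filter G), (E g).Nonempty := by
    filter_upwards [hlim (hA.isOpen.mem_nhds hcA), hn (hB.isOpen.mem_nhds hnB)] with g hgA hgB
    obtain ⟨H, hH, ⟨β, hHM⟩, ⟨β', hHN⟩⟩ := hmn g
    have h1 := (hHM.mul_left g).majority_mem ht (hA.isOpen.mem_nhds hgA)
    have h2 := hHN.majority_mem hr (hB.isOpen.mem_nhds hgB)
    exact H.nonempty_of_mem (inter_mem (mem_map.1 h1) h2)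
  have hE1 : ∀ᶠ g in (F : Filter G), (1 : G) ∉ E g := by
    filter_upwards [hFM.majority_mem ht (hA.compl.isOpen.mem_nhds haA)] with g hg h1
    rw [majority_compl] at hg
    exact hg (by simpa using h1.1)
  have hex : ∀ g, ∃ hs : G × G, (E g).Nonempty → (1 : G) ∉ E g →
      hs.1 ∈ E g ∧ hs.2 ∈ S ∧ hs.1 * hs.2 ∉ E g := by
    intro g
    by_cases hg : (E g).Nonempty ∧ (1 : G) ∉ E g
    · obtain ⟨h, hh, s, hs, hhs⟩ := exists_mul_notMem_of_closure_eq_top hSG hSinv hg.2 hg.1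
      exact ⟨(h, s), fun _ _ => ⟨hh, hs, hhs⟩⟩
    · exact ⟨1, fun h1 h2 => (hg ⟨h1, h2⟩).elim⟩
  choose hs hhs using hex
  have hev : ∀ᶠ g in (F : Filter G),
      (hs g).1 ∈ E g ∧ (hs g).2 ∈ S ∧ (hs g).1 * (hs g).2 ∉ E g := by
    filter_upwards [hEne, hE1] with g h1 h2
    exact hhs g h1 h2
  have hsS : ∀ᶠ g in (F : Filter G), (hs g).2 ∈ S := hev.mono fun g hg => hg.2.1
  have hor : ∀ᶠ g in (F : Filter G), g * (hs g).1 * (hs g).2 ∉ majority G t A ∨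
      (hs g).1 * (hs g).2 ∉ majority G r B := by
    filter_upwards [hev] with g hg
    by_contra! h
    exact hg.2.2 ⟨by simpa [mul_assoc] using h.1, h.2⟩
  rcases Ultrafilter.eventually_or.1 hor with hor | hor
  · obtain ⟨x, hx⟩ := exists_tendsto_of_majority_coboundary hM ht hA hSc hsS
      (f := fun g => g * (hs g).1) (hev.mono fun g hg => hg.1.1) hor
    -- Here g * h converges, so h = g⁻¹ * (g * h) is driven towards b' ∉ B.
    have hinv : Tendsto (fun g : G => g⁻¹) F ((F : Filter G).map (fun g => g⁻¹)) := tendsto_map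
    have := hFN.inv.eventually_mul_mem_majority hr hinv hx (hB.compl.isOpen.mem_nhds hbB)
    obtain ⟨g, hg, hg'⟩ := (this.and hev).exists
    rw [majority_compl, inv_mul_cancel_left] at hg
    exact hg hg'.1.2
  · obtain ⟨x, hx⟩ := exists_tendsto_of_majority_coboundary hN hr hB hSc hsS
      (f := fun g => (hs g).1) (hev.mono fun g hg => hg.1.2) hor
    -- Here h itself converges, so g * h is driven towards a ∉ A.
    have := hFM.eventually_mul_mem_majority ht tendsto_id hx (hA.compl.isOpen.mem_nhds haA)
    obtain ⟨g, hg, hg'⟩ := (this.and hev).exists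
    rw [majority_compl] at hg
    exact hg hg'.1.1

/-- Diagonal argument: the trace of a clopen neighbourhood of m lies in H x for most x, hence in F.
-/
theorem Attracts.eq_of_le_bind (ht : Function.Injective t) {X : Type*} {l : Filter X}
    {H : X → Filter G} {f : X → M} (hH : ∀ᶠ x in l, Attracts (H x) (f x)) {m : M}
    (hf : Tendsto f l (𝓝 m)) {F : Filter G} [F.NeBot] (hF : F ≤ l.bind H) {a : M}
    (ha : Attracts F a) : a = m := by
  by_contra hne
  obtain ⟨A, hA, hmA, haA⟩ := exists_isClopen_of_totally_separated (Ne.symm hne)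
  obtain ⟨b, hb⟩ := ha
  have h1 : majority G t A ∈ F := by
    refine hF (mem_bind'.2 ?_)
    filter_upwards [hH, hf (hA.isOpen.mem_nhds hmA)] with x ⟨β, hx⟩ hxA
    exact hx.majority_mem ht (hA.isOpen.mem_nhds hxA)
  have h2 := hb.majority_mem ht (hA.compl.isOpen.mem_nhds haA)
  rw [majority_compl] at h2
  exact compl_notMem h1 h2

theorem isClosed_jointLimitSet [LocallyCompactSpace G]
    (hM : HasConvergenceProperty G M) (ht : Function.Injective t)
    (hN : HasConvergenceProperty G N) (hr : Function.Injective r) :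
    IsClosed (jointLimitSet G M N) := by
  refine isClosed_of_closure_subset fun p hp => ?_
  have hne : (𝓝[jointLimitSet G M N] p).NeBot := mem_closure_iff_nhdsWithin_neBot.1 hp
  have : ∀ q : M × N, ∃ F : Filter G, q ∈ jointLimitSet G M N →
      F.NeBot ∧ Attracts F q.1 ∧ Attracts F q.2 := by
    intro q
    by_cases hq : q ∈ jointLimitSet G M N
    · obtain ⟨F, hF⟩ := hq
      exact ⟨F, fun _ => hF⟩
    · exact ⟨⊥, fun h => (hq h).elim⟩
  choose H hH using this
  have hev : ∀ᶠ q in 𝓝[jointLimitSet G M N] p,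
      (H q).NeBot ∧ Attracts (H q) q.1 ∧ Attracts (H q) q.2 := by
    filter_upwards [self_mem_nhdsWithin] with q hq using hH q hq
  have hbind : ((𝓝[jointLimitSet G M N] p).bind H).NeBot := by
    refine ⟨fun h0 => ?_⟩
    have h0 := mem_bind'.1 (empty_mem_iff_bot.2 h0)
    obtain ⟨q, hq, hq'⟩ := (hev.and h0).exists
    exact hq.1.ne (empty_mem_iff_bot.1 hq')
  -- W is a diagonal net; it wanders because each H q eventually leaves any fixed compact set.
  obtain ⟨W, hW⟩ := Ultrafilter.exists_le ((𝓝[jointLimitSet G M N] p).bind H)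
  have hwand : IsWandering (W : Filter G) := by
    intro g hg
    obtain ⟨C, hC, hgC⟩ := exists_compact_mem_nhds g
    have h1 : C ∈ (W : Filter G) := Ultrafilter.clusterPt_iff.1 hg hgC
    have h2 : Cᶜ ∈ (W : Filter G) := by
      refine hW (mem_bind'.2 ?_)
      filter_upwards [hev] with q hq
      exact (hq.2.1.isWandering ht).compl_mem hC
    exact compl_notMem h1 h2
  obtain ⟨b, a, ha⟩ := exists_collapses_of_isWandering hM hwand
  obtain ⟨b', a', ha'⟩ := exists_collapses_of_isWandering hN hwand
  have e1 : a = p.1 := Attracts.eq_of_le_bind ht (hev.mono fun q hq => hq.2.1)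
    ((continuous_fst.tendsto p).mono_left nhdsWithin_le_nhds) hW ⟨b, ha⟩
  have e2 : a' = p.2 := Attracts.eq_of_le_bind hr (hev.mono fun q hq => hq.2.2)
    ((continuous_snd.tendsto p).mono_left nhdsWithin_le_nhds) hW ⟨b', ha'⟩
  exact ⟨W, W.neBot, ⟨b, e1 ▸ ha⟩, ⟨b', e2 ▸ ha'⟩⟩

variable (G M N) in
/-- The set of joint limits, as an invariant subset of the product. -/
def jointLimit : SubMulAction G (M × N) where
  carrier := jointLimitSet G M N
  smul_mem' := by
    rintro g p ⟨F, hF, ⟨b, hb⟩, ⟨b', hb'⟩⟩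
    exact ⟨_, hF.map _, ⟨b, hb.mul_left g⟩, ⟨b', hb'.mul_left g⟩⟩

theorem exists_collapses_jointLimit [ContinuousMul G] [ContinuousInv G]
    (hG : CompactlyGeneratedGroup G)
    (hM : HasConvergenceProperty G M) (ht : Function.Injective t)
    (hN : HasConvergenceProperty G N) (hr : Function.Injective r)
    {F : Ultrafilter G} {a : M} (hFM : Attracts (F : Filter G) a)
    {a' : N} (hFN : Attracts (F : Filter G) a') :
    ∃ q p : jointLimit G M N, Collapses (F : Filter G) q p ∧ p.1 = (a, a') := by
  obtain ⟨b, hb⟩ := hFM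
  obtain ⟨b', hb'⟩ := hFN
  have hrep : (b, b') ∈ jointLimit G M N :=
    ⟨(F : Filter G).map (fun g => g⁻¹), inferInstance, ⟨a, hb.inv⟩, ⟨a', hb'.inv⟩⟩
  have hatt : (a, a') ∈ jointLimit G M N := ⟨F, F.neBot, ⟨b, hb⟩, ⟨b', hb'⟩⟩
  refine ⟨⟨(b, b'), hrep⟩, ⟨(a, a'), hatt⟩, ?_, rfl⟩
  intro K hK hbK U hU
  by_contra hcon
  have hcon : ∀ᶠ g in (F : Filter G), ∃ p ∈ K, g • p ∉ U := by
    have := Ultrafilter.eventually_not.2 hcon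
    simpa only [not_forall, exists_prop] using this
  obtain ⟨g₀, p₀, hp₀, -⟩ := hcon.exists
  have : ∀ g : G, ∃ p : jointLimit G M N, (∃ p ∈ K, g • p ∉ U) → p ∈ K ∧ g • p ∉ U := by
    intro g
    by_cases h : ∃ p ∈ K, g • p ∉ U
    · exact h.imp fun p hp _ => hp
    · exact ⟨p₀, fun h' => (h h').elim⟩
  choose p hp using this
  have hp : ∀ᶠ g in (F : Filter G), p g ∈ K ∧ g • p g ∉ U := hcon.mono hp
  obtain ⟨q, hqK, hq⟩ := isCompact_iff_ultrafilter_le_nhds.1 hK (F.map p)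
    (le_principal_iff.2 (hp.mono fun g hg => hg.1))
  have hq : Tendsto p F (𝓝 q) := hq
  have hq1 : Tendsto (fun g => (p g).1.1) F (𝓝 q.1.1) :=
    ((continuous_fst.comp continuous_subtype_val).tendsto q).comp hq
  have hq2 : Tendsto (fun g => (p g).1.2) F (𝓝 q.1.2) :=
    ((continuous_snd.comp continuous_subtype_val).tendsto q).comp hq
  have hlim : Tendsto (fun g => g • (p g).1.1) F (𝓝 a) ∧
      Tendsto (fun g => g • (p g).1.2) F (𝓝 a') := by
    -- As q ≠ (b, b'), one coordinate avoids its repelling point and collapses directly; the ends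
    -- argument controls the other.
    by_cases h1 : q.1.1 = b
    · have h2 : q.1.2 ≠ b' := fun h2 => hbK (by
        rwa [← show q = ⟨(b, b'), hrep⟩ from Subtype.ext (Prod.ext h1 h2)])
      exact ⟨tendsto_smul_of_mem_jointLimitSet hG hM ht hN hr hb hb' (fun g => (p g).2) hq2 h2,
        hb'.tendsto_smul tendsto_id hq2 h2⟩
    · refine ⟨hb.tendsto_smul tendsto_id hq1 h1,
        tendsto_smul_of_mem_jointLimitSet hG hN hr hM ht hb' hb (fun g => ?_) hq1 h1⟩
      exact (p g).2.imp fun F hF => ⟨hF.1, hF.2.2, hF.2.1⟩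
  have hUp : Tendsto (fun g => g • p g) F (𝓝 (⟨(a, a'), hatt⟩ : jointLimit G M N)) := by
    rw [tendsto_subtype_rng]
    exact hlim.1.prodMk_nhds hlim.2
  obtain ⟨g, hg, hg'⟩ := (hp.and (hUp hU)).exists
  exact hg.2 hg'

end Joint

end ConvergenceAction

/-! ### The minimal pullback -/

open ConvergenceAction in
theorem corollaryE {G : Type u} [Group G] [TopologicalSpace G] [IsTopologicalGroup G]
    [LocallyCompactSpace G] [T2Space G]
    (hG : ConvergenceAction.CompactlyGeneratedGroup G)
    {M : Type v} [TopologicalSpace M] [TotallyDisconnectedSpace M] [MulAction G M]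
    (hM : ConvergenceAction.IsMinimalConvergenceAction G M) (hM2 : 2 < ENat.card M)
    {N : Type w} [TopologicalSpace N] [TotallyDisconnectedSpace N] [MulAction G N]
    (hN : ConvergenceAction.IsMinimalConvergenceAction G N) (hN2 : 2 < ENat.card N) :
    ∃ (P : Type (max v w)) (_ : TopologicalSpace P) (_ : MulAction G P)
      (πM : P → M) (πN : P → N),
      ConvergenceAction.IsMinimalPullback.{y} G πM πN := by
  obtain ⟨t, ht⟩ := exists_injective_fin_three hM2
  obtain ⟨r, hr⟩ := exists_injective_fin_three hN2
  have := hM.compactSpace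
  have := hM.t2Space
  have := hM.continuousSMul
  have := hN.compactSpace
  have := hN.t2Space
  have := hN.continuousSMul
  have hcM := hM.convergence
  have hcN := hN.convergence
  refine ⟨jointLimit G M N, inferInstance, inferInstance, fun p => p.1.1, fun p => p.1.2,
    ⟨⟨?_, ?_, ?_, ?_, ?_⟩, ?_⟩⟩
  · refine ⟨?_, inferInstance, ?_, ?_, ?_⟩
    · exact isCompact_iff_compactSpace.1 (isClosed_jointLimitSet hcM ht hcN hr).isCompact
    · exact ⟨(continuous_fst.smul (continuous_subtype_val.comp continuous_snd)).subtype_mk _⟩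
    · intro F hF hwand
      obtain ⟨W, hW⟩ := Ultrafilter.exists_le F
      obtain ⟨b, a, ha⟩ := exists_collapses_of_isWandering hcM (hwand.mono hW)
      obtain ⟨b', a', ha'⟩ := exists_collapses_of_isWandering hcN (hwand.mono hW)
      obtain ⟨q, p, hqp, -⟩ := exists_collapses_jointLimit hG hcM ht hcN hr ⟨b, ha⟩ ⟨b', ha'⟩
      exact ⟨W, hW, W.neBot, q, p, hqp⟩
    · refine eq_univ_of_forall fun p => ?_
      obtain ⟨F, hF, h1, h2⟩ := p.2
      obtain ⟨W, hW⟩ := Ultrafilter.exists_le F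
      obtain ⟨q, p', hqp, hp'⟩ := exists_collapses_jointLimit hG hcM ht hcN hr
        (h1.mono hW) (h2.mono hW)
      have : p' = p := Subtype.ext hp'
      exact ⟨q, W, W.neBot, this ▸ hqp⟩
  · exact ⟨continuous_fst.comp continuous_subtype_val, fun g s => rfl⟩
  · intro m
    obtain ⟨b, F, hF, h⟩ : m ∈ limitSet G M := hM.limitSet_eq ▸ mem_univ m
    obtain ⟨W, hW⟩ := Ultrafilter.exists_le F
    have hm : Attracts (W : Filter G) m := ⟨b, h.mono hW⟩
    -- Wandering does not depend on the space acted on, so a net collapsing on M also collapses on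
    -- N, after refinement to an ultrafilter.
    obtain ⟨b', a', ha'⟩ := exists_collapses_of_isWandering hcN (hm.isWandering ht)
    exact ⟨⟨(m, a'), W, W.neBot, hm, ⟨b', ha'⟩⟩, rfl⟩
  · exact ⟨continuous_snd.comp continuous_subtype_val, fun g s => rfl⟩
  · intro n
    obtain ⟨b, F, hF, h⟩ : n ∈ limitSet G N := hN.limitSet_eq ▸ mem_univ n
    obtain ⟨W, hW⟩ := Ultrafilter.exists_le F
    have hn : Attracts (W : Filter G) n := ⟨b, h.mono hW⟩
    obtain ⟨b', a', ha'⟩ := exists_collapses_of_isWandering hcM (hn.isWandering hr)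
    exact ⟨⟨(a', n), W, W.neBot, ⟨b', ha'⟩, hn⟩, rfl⟩
  · intro T _ _ pM pN hT
    have := hT.action.compactSpace
    refine ⟨fun x => ⟨(pM x, pN x), ?_⟩, ⟨?_, ?_⟩, rfl, rfl⟩
    · obtain ⟨b, F, hF, h⟩ : x ∈ limitSet G T := hT.action.limitSet_eq ▸ mem_univ x
      exact ⟨F, hF, ⟨_, h.map hT.left_morphism hT.left_surjective⟩,
        ⟨_, h.map hT.right_morphism hT.right_surjective⟩⟩
    · exact (hT.left_morphism.continuous.prodMk hT.right_morphism.continuous).subtype_mk _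
    · intro g s
      exact Subtype.ext (Prod.ext (hT.left_morphism.map_smul g s) (hT.right_morphism.map_smul g s))
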